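/- Throughout, "set" and "small" refer to sets, all categories have small hom-sets, classes of objects or morphisms may be proper classes, and $\lambda$ is a regular cardinal; limits and colimits are over small diagrams. An object $K$ of a category $\mathcal K$ is $\lambda$-presentable if $\hom(K,-)\colon\mathcal K\to\mathbf{Set}$ preserves $\lambda$-filtered colimits. A category is *class-$\lambda$-accessible* if it has $\lambda$-filtered colimits and a (possibly proper) class $\mathcal A$ of $\lambda$-presentable objects such that every object is a $\lambda$-filtered colimit of objects from $\mathcal A$. It is *class-locally $\lambda$-presentable* if it is moreover complete and cocomplete. A full subcategory of $\mathcal K$ is *strongly $\lambda$-accessibly embedded* if it is closed under $\lambda$-filtered colimits in $\mathcal K$ and its inclusion into $\mathcal K$ sends $\lambda$-presentable objects to $\lambda$-presentable objects. Let $\mathcal K^{\to}$ be the category of morphisms of $\mathcal K$ (with commutative squares as morphisms). A class $\mathcal C$ of morphisms of $\mathcal K$ is *cone-coreflective* if for every morphism $f$ of $\mathcal K$ the comma category $\mathcal C\downarrow f$, with $\mathcal C$ regarded as a full subcategory of $\mathcal K^{\to}$, has a weakly terminal set of objects (a set such that every object admits a morphism to a member of it). Let $\operatorname{cof}(\mathcal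 C)$ be the smallest class of morphisms containing the isomorphisms and the pushouts of morphisms from $\mathcal C$ and closed under transfinite compositions and under retracts in $\mathcal K^{\to}$. A *weak factorization system* $(\mathcal L,\mathcal R)$ is a pair of classes of morphisms such that $\mathcal R$ is the class of all morphisms with the right lifting property against $\mathcal L$, $\mathcal L$ is the class of all morphisms with the left lifting property against $\mathcal R$, and every morphism is $gf$ with $f\in\mathcal L$ and $g\in\mathcal R$. It is *cofibrantly class-$\lambda$-generated* if 1. $\mathcal L=\operatorname{cof}(\mathcal C)$ for some cone-coreflective class $\mathcal C$ of morphisms all of whose domains and codomains are $\lambda$-presentable, and 2. every morphism $f\colon A\to B$ with $A,B$ $\lambda$-presentable has a factorization $A\xrightarrow{f_1}M\xrightarrow{f_2}B$ with $f_1\in\mathcal L$, $f_2\in\mathcal R$ and $M$ $\lambda$-presentable. **Theorem.** Let $\mathcal K$ be a class-locally $\lambda$-presentable category and $(\mathcal L,\mathcal R)$ a cofibrantly class-$\lambda$-generated weak factorization system in $\mathcal K$. Then $\mathcal R$, regarded as a full subcategory of $\mathcal K^{\to}$, is class-$\lambda$-accessible and is strongly $\lambda$-accessibly embedded in $\mathcal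 K^{\to}$. -/

import Mathlib

open CategoryTheory Limits

universe w v u

namespace CategoryTheory

/-- `C` is class-`κ`-accessible: it has (small) `κ`-filtered colimits, and there is a class `P`
of `κ`-presentable objects, with no smallness condition on `P`, such that every object is a small
`κ`-filtered colimit of objects from `P`. -/
class IsClassAccessible (C : Type u) [Category.{w} C] (κ : Cardinal.{w}) [Fact κ.IsRegular] :
    Prop extends HasCardinalFilteredColimits.{w} C κ where
  exists_generator : ∃ P : ObjectProperty C, P.IsCardinalFilteredGenerator κ

/-- `C` is class-locally `κ`-presentable: complete, cocomplete and class-`κ`-accessible. -/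
class IsClassLocallyPresentable (C : Type u) [Category.{w} C] (κ : Cardinal.{w})
    [Fact κ.IsRegular] : Prop
    extends IsClassAccessible C κ, HasLimitsOfSize.{w, w} C, HasColimitsOfSize.{w, w} C

/-- A full subcategory (given by the property `P` of objects of `C`) is strongly `κ`-accessibly
embedded: it is closed in `C` under small `κ`-filtered colimits, and the inclusion functor
preserves `κ`-presentable objects. -/
structure ObjectProperty.IsStronglyAccessiblyEmbedded {C : Type u} [Category.{v} C]
    (P : ObjectProperty C) (κ : Cardinal.{w}) [Fact κ.IsRegular] : Prop where
  closedUnderColimits (J : Type w) [SmallCategory J] [IsCardinalFiltered J κ] :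
    P.IsClosedUnderColimitsOfShape J
  preserves_presentable (X : P.FullSubcategory) :
    IsCardinalPresentable X κ → IsCardinalPresentable (P.ι.obj X) κ

namespace MorphismProperty

variable {C : Type u} [Category.{w} C]

/-- A class of morphisms of `C`, as a class of objects of the arrow category of `C`. -/
def arrowProperty (W : MorphismProperty C) : ObjectProperty (Arrow C) :=
  fun f => W f.hom

/-- `W` is cone-coreflective: for every morphism `f`, the comma category `W ↓ f`, where `W` is
viewed as a full subcategory of the arrow category, has a weakly terminal set of objects. -/
def IsConeCoreflective (W : MorphismProperty C) : Prop :=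
  ∀ f : Arrow C, ∃ (I : Type w) (T : I → CostructuredArrow W.arrowProperty.ι f),
    ∀ X : CostructuredArrow W.arrowProperty.ι f, ∃ i : I, Nonempty (X ⟶ T i)

/-- `cof W` is the smallest class of morphisms which contains the isomorphisms and the pushouts
of morphisms from `W`, and which is closed under transfinite compositions and retracts. -/
def cof (W : MorphismProperty C) : MorphismProperty C :=
  sInf { V | isomorphisms C ≤ V ∧ W.pushouts ≤ V ∧
    IsStableUnderTransfiniteComposition.{w} V ∧ V.IsStableUnderRetracts }

/-- `(L, R)` is a cofibrantly class-`κ`-generated weak factorization system. -/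
structure IsCofibrantlyClassGenerated (L R : MorphismProperty C) (κ : Cardinal.{w})
    [Fact κ.IsRegular] : Prop where
  isWeakFactorizationSystem : IsWeakFactorizationSystem L R
  /-- `L` is generated by a cone-coreflective class of morphisms having `κ`-presentable domains
  and `κ`-presentable codomains. -/
  exists_generating : ∃ W : MorphismProperty C, W.IsConeCoreflective ∧ L = W.cof ∧
    ∀ ⦃A B : C⦄ (f : A ⟶ B), W f → IsCardinalPresentable A κ ∧ IsCardinalPresentable B κ
  /-- Morphisms between `κ`-presentable objects have a weak factorization through a
  `κ`-presentable object. -/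
  exists_factorization : ∀ ⦃A B : C⦄ (f : A ⟶ B),
    IsCardinalPresentable A κ → IsCardinalPresentable B κ →
      ∃ (M : C) (i : A ⟶ M) (p : M ⟶ B),
        L i ∧ R p ∧ i ≫ p = f ∧ IsCardinalPresentable M κ

end MorphismProperty

end CategoryTheory

/-! Since `R = W.rlp` and each arrow of `W` is `κ`-presentable in `Arrow C`, a lifting problem
against a `κ`-filtered colimit already lives at some stage, so `R` is closed under `κ`-filtered
colimits.

Every arrow is a `κ`-filtered colimit of arrows between `κ`-presentable objects
(`ColimitOfShape.exists_arrows`). If `f` is such an arrow and `f ⟶ g` has target in `R`, factor `f =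
i ≫ q` through a `κ`-presentable object; lifting `i` against `g` yields `f ⟶ q ⟶ g` with `q`
presentable and in `R`. By `exists_colimitsOfShape_of_fac`, these `q` can replace the `f` in the
diagram of `g`, so they generate `R`. A presentable object of `R` is then a retract of such a `q`,
hence presentable in `Arrow C`. -/

namespace CategoryTheory

/-! ### Filteredness of comma categories -/

section Comma

variable {A : Type*} {B : Type*} {T : Type*} [Category* A] [Category* B] [Category* T]

/-- If `A` and `B` are `κ`-filtered and `R : B ⥤ T` is final, then `Comma L R` is `κ`-filtered. -/
lemma isCardinalFiltered_comma_of_final (L : A ⥤ T) (R : B ⥤ T) [R.Final]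
    (κ : Cardinal.{w}) [Fact κ.IsRegular] [IsCardinalFiltered A κ] [IsCardinalFiltered B κ] :
    IsCardinalFiltered (Comma L R) κ := by
  have := isFiltered_of_isCardinalFiltered A κ
  have := isFiltered_of_isCardinalFiltered B κ
  obtain ⟨h₁, h₂⟩ := (Functor.final_iff_of_isFiltered R).1 inferInstance
  rw [isCardinalFiltered_iff]
  refine ⟨fun ι X hι ↦ ?_, fun ι X Y f hι ↦ ?_⟩
  · let a := IsCardinalFiltered.max (fun i ↦ (X i).left) hι
    let ta (i : ι) : (X i).left ⟶ a := IsCardinalFiltered.toMax (fun i ↦ (X i).left) hι i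
    let b := IsCardinalFiltered.max (fun i ↦ (X i).right) hι
    let tb (i : ι) : (X i).right ⟶ b := IsCardinalFiltered.toMax (fun i ↦ (X i).right) hι i
    obtain ⟨b', ⟨φ⟩⟩ := h₁ (L.obj a)
    let u := IsFiltered.leftToMax b b'
    let v := IsFiltered.rightToMax b b'
    -- The squares need not commute yet: finality corrects each one separately, and `wideSpan`
    -- merges these fewer than `κ` corrections.
    choose c t ht using fun i ↦ h₂ (L.map (ta i) ≫ φ ≫ R.map v)
      ((X i).hom ≫ R.map (tb i ≫ u))
    obtain ⟨m, s, d, hs⟩ := IsCardinalFiltered.wideSpan t hι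
    refine ⟨⟨a, m, φ ≫ R.map (v ≫ d)⟩, fun i ↦ ⟨⟨ta i, tb i ≫ u ≫ d, ?_⟩⟩⟩
    have := ht i =≫ R.map (s i)
    simp only [Category.assoc, ← Functor.map_comp, hs] at this
    simpa using this
  · let a := IsCardinalFiltered.coeq (fun i ↦ (f i).left) hι
    let p : Y.left ⟶ a := IsCardinalFiltered.coeqHom (fun i ↦ (f i).left) hι
    let b := IsCardinalFiltered.coeq (fun i ↦ (f i).right) hι
    let q : Y.right ⟶ b := IsCardinalFiltered.coeqHom (fun i ↦ (f i).right) hι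
    let p' : X.left ⟶ a := IsCardinalFiltered.toCoeq (fun i ↦ (f i).left) hι
    let q' : X.right ⟶ b := IsCardinalFiltered.toCoeq (fun i ↦ (f i).right) hι
    have hp (i : ι) : (f i).left ≫ p = p' :=
      IsCardinalFiltered.coeq_condition (fun i ↦ (f i).left) hι i
    have hq (i : ι) : (f i).right ≫ q = q' :=
      IsCardinalFiltered.coeq_condition (fun i ↦ (f i).right) hι i
    obtain ⟨b', ⟨φ⟩⟩ := h₁ (L.obj a)
    let u := IsFiltered.leftToMax b b'
    let v := IsFiltered.rightToMax b b'
    obtain ⟨c, t, ht⟩ := h₂ (L.map p ≫ φ ≫ R.map v) (Y.hom ≫ R.map (q ≫ u))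
    -- The map out of `X` needs its own correction: for empty `ι` it does not factor through `Y`.
    obtain ⟨c', t', ht'⟩ := h₂ (L.map p' ≫ φ ≫ R.map (v ≫ t)) (X.hom ≫ R.map (q' ≫ u ≫ t))
    refine ⟨⟨a, c', φ ≫ R.map (v ≫ t ≫ t')⟩, ⟨p, q ≫ u ≫ t ≫ t', ?_⟩,
      ⟨p', q' ≫ u ≫ t ≫ t', ?_⟩, fun i ↦ ?_⟩
    · simpa using ht =≫ R.map t'
    · simpa using ht'
    · ext
      · exact hp i
      · simp [reassoc_of% hq i]

end Comma

/-! ### Presentability and generators in arrow categories -/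

section Arrow

variable {C : Type u} [Category.{v} C] (κ : Cardinal.{w}) [Fact κ.IsRegular]

/-- An arrow between `κ`-presentable objects is `κ`-presentable in the category of arrows. -/
lemma isCardinalPresentable_arrow [HasCardinalFilteredColimits.{w} C κ] (f : Arrow C)
    [IsCardinalPresentable f.left κ] [IsCardinalPresentable f.right κ] :
    IsCardinalPresentable f κ where
  preservesColimitOfShape J _ _ := ⟨fun {F} ↦ ⟨fun {c} hc ↦ ⟨by
    have := essentiallySmallSelf J
    have := isFiltered_of_isCardinalFiltered J κ
    have := HasCardinalFilteredColimits.hasColimitsOfShape (κ := κ) C J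
    have hl := isColimitOfPreserves Arrow.leftFunc hc
    have hr := isColimitOfPreserves Arrow.rightFunc hc
    refine Types.FilteredColimit.isColimitOf' _ _ (fun (g : f ⟶ c.pt) ↦ ?_)
      (fun j (g₁ : f ⟶ F.obj j) (g₂ : f ⟶ F.obj j) (hg : g₁ ≫ c.ι.app j = g₂ ≫ c.ι.app j) ↦ ?_)
    · obtain ⟨i, (a : f.left ⟶ (F.obj i).left), (ha : a ≫ (c.ι.app i).left = g.left)⟩ :=
        IsCardinalPresentable.exists_hom_of_isColimit κ hl g.left
      obtain ⟨i', (b : f.right ⟶ (F.obj i').right), (hb : b ≫ (c.ι.app i').right = g.right)⟩ :=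
        IsCardinalPresentable.exists_hom_of_isColimit κ hr g.right
      -- The two components descend separately; their square commutes in the colimit, hence at a
      -- later stage, because `f.left` is presentable.
      obtain ⟨k, s, t, (hst : (a ≫ (F.obj i).hom) ≫ (F.map s).right =
          (f.hom ≫ b) ≫ (F.map t).right)⟩ :=
        IsCardinalPresentable.exists_eq_of_isColimit κ hr
        (show f.left ⟶ (F.obj i).right from a ≫ (F.obj i).hom)
        (show f.left ⟶ (F.obj i').right from f.hom ≫ b) (by
          change (a ≫ (F.obj i).hom) ≫ (c.ι.app i).right = (f.hom ≫ b) ≫ (c.ι.app i').right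
          have h₁ : (c.ι.app i).left ≫ c.pt.hom = (F.obj i).hom ≫ (c.ι.app i).right :=
            Arrow.w (c.ι.app i)
          have h₂ : g.left ≫ c.pt.hom = f.hom ≫ g.right := Arrow.w g
          rw [Category.assoc, Category.assoc, hb, ← h₁, reassoc_of% ha, h₂])
      have h₁ : (F.map s).left ≫ (c.ι.app k).left = (c.ι.app i).left :=
        congr_arg CommaMorphism.left (c.w s)
      have h₂ : (F.map t).right ≫ (c.ι.app k).right = (c.ι.app i').right :=
        congr_arg CommaMorphism.right (c.w t)
      refine ⟨k, Arrow.homMk (a ≫ (F.map s).left) (b ≫ (F.map t).right) ?_, ?_⟩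
      · have h₃ : (F.map s).left ≫ (F.obj k).hom = (F.obj i).hom ≫ (F.map s).right :=
          Arrow.w (F.map s)
        simp only [Category.assoc] at hst ⊢
        rw [← hst, h₃]
      · refine Arrow.hom_ext _ _ ?_ ?_
        · change g.left = (a ≫ (F.map s).left) ≫ (c.ι.app k).left
          rw [Category.assoc, h₁, ha]
        · change g.right = (b ≫ (F.map t).right) ≫ (c.ι.app k).right
          rw [Category.assoc, h₂, hb]
    · obtain ⟨k, s, (hs : g₁.left ≫ (F.map s).left = g₂.left ≫ (F.map s).left)⟩ :=
        IsCardinalPresentable.exists_eq_of_isColimit' κ hl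
          g₁.left g₂.left (congr_arg CommaMorphism.left hg)
      obtain ⟨k', t, ht⟩ := IsCardinalPresentable.exists_eq_of_isColimit' κ hr
        (g₁ ≫ F.map s).right (g₂ ≫ F.map s).right
        (congr_arg CommaMorphism.right (show (g₁ ≫ F.map s) ≫ c.ι.app k =
          (g₂ ≫ F.map s) ≫ c.ι.app k by simpa using hg))
      refine ⟨k', s ≫ t, ?_⟩
      change g₁ ≫ F.map (s ≫ t) = g₂ ≫ F.map (s ≫ t)
      rw [F.map_comp]
      refine Arrow.hom_ext _ _ ?_ ?_
      · change g₁.left ≫ (F.map s).left ≫ (F.map t).left =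
          g₂.left ≫ (F.map s).left ≫ (F.map t).left
        rw [reassoc_of% hs]
      · rw [← Category.assoc, ← Category.assoc]
        exact ht⟩⟩⟩

namespace ObjectProperty

/-- The arrows whose source and target satisfy a given property of objects. -/
def arrows (P : ObjectProperty C) : ObjectProperty (Arrow C) :=
  fun f ↦ P f.left ∧ P f.right

variable {κ}

lemma arrows_isCardinalPresentable_le [HasCardinalFilteredColimits.{w} C κ] :
    (CategoryTheory.isCardinalPresentable C κ).arrows ≤ isCardinalPresentable (Arrow C) κ := by
  rintro f ⟨_ : IsCardinalPresentable f.left κ, _ : IsCardinalPresentable f.right κ⟩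
  exact isCardinalPresentable_arrow κ f

end ObjectProperty

end Arrow

section

variable {C : Type u} [Category.{w} C] {κ : Cardinal.{w}} [Fact κ.IsRegular]

namespace ObjectProperty

/-- The index category consists of the maps from a stage of `p` to a stage of `q` compatible with
`f`. Both projections are final because `R` is, so sources and targets have the right colimits. -/
lemma ColimitOfShape.exists_arrows {f : Arrow C}
    {I K : Type w} [SmallCategory I] [SmallCategory K]
    [IsCardinalFiltered I κ] [IsCardinalFiltered K κ]
    (p : (CategoryTheory.isCardinalPresentable C κ).ColimitOfShape I f.left)
    (q : (CategoryTheory.isCardinalPresentable C κ).ColimitOfShape K f.right) :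
    ∃ (J : Type w) (_ : SmallCategory J) (_ : IsCardinalFiltered J κ),
      (CategoryTheory.isCardinalPresentable C κ).arrows.colimitsOfShape J f := by
  have := isFiltered_of_isCardinalFiltered I κ
  have := isFiltered_of_isCardinalFiltered K κ
  have := essentiallySmallSelf K
  let L := p.toCostructuredArrow ⋙ CostructuredArrow.map f.hom
  let R := q.toCostructuredArrow
  have : R.Final := inferInstance
  have := isCardinalFiltered_comma_of_final L R κ
  have : (Comma.snd L R).Final := inferInstance
  refine ⟨Comma L R, inferInstance, inferInstance, ⟨?_⟩⟩
  exact
    { diag :=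
        { obj X := Arrow.mk X.hom.left.hom
          map φ := Arrow.homMk (p.diag.map φ.left) (q.diag.map φ.right)
            (congr_arg (fun g ↦ g.left.hom) φ.w) }
      ι :=
        { app X := Arrow.homMk (p.ι.app X.left) (q.ι.app X.right) (CostructuredArrow.w X.hom).symm
          naturality X Y φ := Arrow.hom_ext _ _ (p.ι.naturality φ.left) (q.ι.naturality φ.right) }
      isColimit := Comma.fstSndJointlyReflectColimit
        (IsColimit.ofIsoColimit (p.reindex (Comma.fst L R)).isColimit (Cocone.ext (Iso.refl _)))
        (IsColimit.ofIsoColimit (q.reindex (Comma.snd L R)).isColimit (Cocone.ext (Iso.refl _)))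
      prop_diag_obj X := ⟨p.prop_diag_obj _, q.prop_diag_obj _⟩ }

/-- In a category of arrows, the arrows between `κ`-presentable objects form a
`κ`-filtered generator. -/
lemma IsCardinalFilteredGenerator.arrows [HasCardinalFilteredColimits.{w} C κ]
    {P : ObjectProperty C} (hP : P.IsCardinalFilteredGenerator κ) :
    (CategoryTheory.isCardinalPresentable C κ).arrows.IsCardinalFilteredGenerator κ where
  le_isCardinalPresentable := arrows_isCardinalPresentable_le
  exists_colimitsOfShape f := by
    obtain ⟨_, _, _, ⟨p⟩⟩ := hP.exists_colimitsOfShape f.left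
    obtain ⟨_, _, _, ⟨q⟩⟩ := hP.exists_colimitsOfShape f.right
    exact (p.ofLE hP.le_isCardinalPresentable).exists_arrows (q.ofLE hP.le_isCardinalPresentable)

/-! ### Replacing the objects of a filtered diagram -/

namespace ColimitOfShape

variable {J : Type w} [SmallCategory J] [IsCardinalFiltered J κ] {X : C}

section

variable (p : (CategoryTheory.isCardinalPresentable C κ).ColimitOfShape J X) {M : J → C}
  (r : ∀ j, p.diag.obj j ⟶ M j) (s : ∀ j, M j ⟶ X) (hrs : ∀ j, r j ≫ s j = p.ι.app j)

include hrs

/-- Two morphisms over `X` from a `κ`-presentable object to objects `M j` become equal in a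
further object `M k`. -/
lemma exists_over_eq {Y : C} [IsCardinalPresentable Y κ] {j₁ j₂ : J}
    [IsCardinalPresentable (M j₁) κ] [IsCardinalPresentable (M j₂) κ]
    (f₁ : Y ⟶ M j₁) (f₂ : Y ⟶ M j₂) (h : f₁ ≫ s j₁ = f₂ ≫ s j₂) :
    ∃ (k : J) (a₁ : M j₁ ⟶ M k) (a₂ : M j₂ ⟶ M k),
      a₁ ≫ s k = s j₁ ∧ a₂ ≫ s k = s j₂ ∧ f₁ ≫ a₁ = f₂ ≫ a₂ := by
  have := essentiallySmallSelf J
  -- Each `M j` maps back to a stage of `p`; the comparison is made there, and `r k` returns to some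
  -- `M k`.
  obtain ⟨k₁, g₁, hg₁⟩ := IsCardinalPresentable.exists_hom_of_isColimit κ p.isColimit (s j₁)
  obtain ⟨k₂, g₂, hg₂⟩ := IsCardinalPresentable.exists_hom_of_isColimit κ p.isColimit (s j₂)
  dsimp at hg₁ hg₂
  obtain ⟨k, u₁, u₂, hu⟩ := IsCardinalPresentable.exists_eq_of_isColimit κ p.isColimit
    (f₁ ≫ g₁) (f₂ ≫ g₂) (by simp [hg₁, hg₂, h])
  refine ⟨k, g₁ ≫ p.diag.map u₁ ≫ r k, g₂ ≫ p.diag.map u₂ ≫ r k, ?_, ?_, ?_⟩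
  · simp only [Category.assoc, hrs, p.w, hg₁]
  · simp only [Category.assoc, hrs, p.w, hg₂]
  · simpa using hu =≫ r k

/-- The full subcategory of `Over X` on the objects `M j` is `κ`-filtered. -/
lemma isCardinalFiltered_inducedCategory (hM : ∀ j, IsCardinalPresentable (M j) κ) :
    IsCardinalFiltered (InducedCategory (Over X) (fun j ↦ Over.mk (s j))) κ := by
  have := essentiallySmallSelf J
  have := isFiltered_of_isCardinalFiltered J κ
  rw [isCardinalFiltered_iff]
  refine ⟨fun ι (j : ι → J) hι ↦ ?_, fun ι (j k : J) f hι ↦ ?_⟩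
  · choose k g hg using fun i ↦
      IsCardinalPresentable.exists_hom_of_isColimit κ p.isColimit (s (j i))
    dsimp at hg
    let m := IsCardinalFiltered.max k hι
    exact ⟨m, fun i ↦ ⟨InducedCategory.homMk (Over.homMk
      (g i ≫ p.diag.map (IsCardinalFiltered.toMax k hι i) ≫ r m)
        (by dsimp; simp only [Category.assoc, hrs, p.w, hg, m]))⟩⟩
  · obtain ⟨l, g, hg⟩ := IsCardinalPresentable.exists_hom_of_isColimit κ p.isColimit (s k)
    dsimp at hg
    have hf (i : ι) : (f i).hom.left ≫ s k = s j := Over.w (f i).hom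
    obtain ⟨l', g', hg'⟩ := IsCardinalPresentable.exists_hom_of_isColimit κ p.isColimit (s j)
    dsimp at hg'
    let u := IsFiltered.leftToMax l l'
    let u' := IsFiltered.rightToMax l l'
    have : IsCardinalPresentable (Over.mk (s j)).left κ := hM j
    choose m a hm using fun i ↦ IsCardinalPresentable.exists_eq_of_isColimit' κ p.isColimit
      ((f i).hom.left ≫ g ≫ p.diag.map u) (g' ≫ p.diag.map u') (by
        simp only [Category.assoc, p.w, hg, hg', hf])
    obtain ⟨n, c, d, hc⟩ := IsCardinalFiltered.wideSpan a hι
    refine ⟨n, InducedCategory.homMk (Over.homMk (g ≫ p.diag.map (u ≫ d) ≫ r n) ?_),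
      InducedCategory.homMk (Over.homMk (g' ≫ p.diag.map (u' ≫ d) ≫ r n) ?_), fun i ↦ ?_⟩
    · dsimp; simp only [Category.assoc, hrs, p.w, hg]
    · dsimp; simp only [Category.assoc, hrs, p.w, hg']
    · ext
      have := hm i =≫ (p.diag.map (c i) ≫ r n)
      simp only [Category.assoc, ← Functor.map_comp_assoc, hc] at this
      simpa using this

/-- If the structural morphisms `p.diag.obj j ⟶ X` of a `κ`-filtered colimit of `κ`-presentable
objects factor through `κ`-presentable objects `M j`, then `X` is a `κ`-filtered colimit of
the objects `M j`. -/
lemma exists_colimitsOfShape_of_fac (hM : ∀ j, IsCardinalPresentable (M j) κ)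
    {Q : ObjectProperty C} (hQ : ∀ j, Q (M j)) :
    ∃ (J' : Type w) (_ : SmallCategory J') (_ : IsCardinalFiltered J' κ),
      Q.colimitsOfShape J' X := by
  have := essentiallySmallSelf J
  have := p.isCardinalFiltered_inducedCategory r s hrs hM
  have hp (j : J) : IsCardinalPresentable (p.diag.obj j) κ := p.prop_diag_obj j
  -- The `M j` are chosen without functoriality in `j`, so all morphisms over `X` between them are
  -- used instead of those of `J`.
  let F : InducedCategory (Over X) (fun j ↦ Over.mk (s j)) ⥤ C := inducedFunctor _ ⋙ Over.forget X
  let τ (t : Cocone F) (j : J) : M j ⟶ t.pt := t.ι.app j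
  have hF (t : Cocone F) {i j : J} (a : M i ⟶ M j) (h : a ≫ s j = s i) :
      a ≫ τ t j = τ t i :=
    t.ι.naturality (X := i) (Y := j) (InducedCategory.homMk (Over.homMk a h)) |>.trans
      (Category.comp_id _)
  -- Cocone legs depend only on the composite to `X`; this makes the maps `r j ≫ τ t j` a cocone on
  -- `p.diag`.
  have hF' (t : Cocone F) {Y : C} [IsCardinalPresentable Y κ] {i j : J}
      (a : Y ⟶ M i) (b : Y ⟶ M j) (h : a ≫ s i = b ≫ s j) :
      a ≫ τ t i = b ≫ τ t j := by
    obtain ⟨k, a₁, a₂, h₁, h₂, h₃⟩ := p.exists_over_eq r s hrs a b h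
    rw [← hF t a₁ h₁, ← hF t a₂ h₂, reassoc_of% h₃]
  let c (t : Cocone F) : Cocone p.diag :=
    { pt := t.pt
      ι :=
        { app j := r j ≫ τ t j
          naturality i j u := by
            have := hF' t (p.diag.map u ≫ r j) (r i) (by simp [hrs])
            rw [Category.assoc] at this
            exact this.trans (Category.comp_id _).symm } }
  have hc (t : Cocone F) (j : J) : p.ι.app j ≫ p.isColimit.desc (c t) = r j ≫ τ t j :=
    p.isColimit.fac (c t) j
  refine ⟨InducedCategory (Over X) (fun j ↦ Over.mk (s j)), inferInstance, inferInstance, ⟨?_⟩⟩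
  exact
    { diag := F
      ι :=
        { app j := s j
          naturality i j u := (Over.w u.hom).trans (Category.comp_id _).symm }
      isColimit :=
        { desc t := p.isColimit.desc (c t)
          fac t j := by
            obtain ⟨k, g, hg⟩ := IsCardinalPresentable.exists_hom_of_isColimit κ p.isColimit (s j)
            dsimp at hg
            change s j ≫ p.isColimit.desc (c t) = τ t j
            rw [← hg, Category.assoc, hc, ← Category.assoc]
            exact hF t _ (by rw [Category.assoc, hrs, hg])
          uniq t m hm := p.isColimit.hom_ext fun j ↦ by
            have h : s j ≫ m = τ t j := hm j
            have := hc t j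
            dsimp
            rw [this, ← hrs, Category.assoc, h] }
      prop_diag_obj j := hQ j }

end

end ColimitOfShape

/-! ### Generators of full subcategories -/

/-- If a property `P` is closed under `κ`-filtered colimits, an object of the full subcategory
is `κ`-presentable as soon as it is in the ambient category. -/
lemma isCardinalPresentable_fullSubcategory [HasCardinalFilteredColimits.{w} C κ]
    (P : ObjectProperty C)
    (hP : ∀ (J : Type w) [SmallCategory J] [IsCardinalFiltered J κ],
      P.IsClosedUnderColimitsOfShape J)
    (X : P.FullSubcategory) [IsCardinalPresentable X.obj κ] :
    IsCardinalPresentable X κ where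
  preservesColimitOfShape J _ _ := by
    have := hP J
    have := HasCardinalFilteredColimits.hasColimitsOfShape (κ := κ) C J
    have := preservesColimitsOfShape_of_isCardinalPresentable X.obj κ J
    exact preservesColimitsOfShape_of_natIso (F := P.ι ⋙ coyoneda.obj (.op X.obj))
      (NatIso.ofComponents (fun Y ↦ (P.fullyFaithfulι.homEquiv (X := X) (Y := Y)).symm.toIso))

/-- Let `P` be a property of objects of `C` which is closed under `κ`-filtered colimits.
If any morphism from an object of a `κ`-filtered generator to an object satisfying `P` factors
through a `κ`-presentable object satisfying `P`, then the `κ`-presentable objects satisfying `P`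
form a `κ`-filtered generator of the full subcategory. -/
lemma IsCardinalFilteredGenerator.fullSubcategory [HasCardinalFilteredColimits.{w} C κ]
    {G : ObjectProperty C} (hG : G.IsCardinalFilteredGenerator κ) (P : ObjectProperty C)
    (hP : ∀ (J : Type w) [SmallCategory J] [IsCardinalFiltered J κ],
      P.IsClosedUnderColimitsOfShape J)
    (hfac : ∀ ⦃D X : C⦄ (f : D ⟶ X), G D → P X →
      ∃ (M : C) (r : D ⟶ M) (s : M ⟶ X), r ≫ s = f ∧ P M ∧ IsCardinalPresentable M κ) :
    ((CategoryTheory.isCardinalPresentable C κ).inverseImage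
      P.ι).IsCardinalFilteredGenerator κ where
  le_isCardinalPresentable X (hX : IsCardinalPresentable X.obj κ) :=
    isCardinalPresentable_fullSubcategory P hP X
  exists_colimitsOfShape X := by
    obtain ⟨J, _, _, ⟨p⟩⟩ := hG.exists_colimitsOfShape X.obj
    choose M r s hrs hM hM' using fun j ↦ hfac (p.ι.app j) (p.prop_diag_obj j) X.property
    obtain ⟨J', _, _, ⟨q⟩⟩ := (p.ofLE hG.le_isCardinalPresentable).exists_colimitsOfShape_of_fac
      r s hrs hM' (Q := P ⊓ CategoryTheory.isCardinalPresentable C κ) (fun j ↦ ⟨hM j, hM' j⟩)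
    exact ⟨J', inferInstance, inferInstance,
      ⟨{ diag := P.lift q.diag (fun j ↦ (q.prop_diag_obj j).1)
         ι :=
          { app j := ObjectProperty.homMk (q.ι.app j)
            naturality i j u := by
              ext
              exact q.ι.naturality u }
         isColimit := isColimitOfReflects P.ι q.isColimit
         prop_diag_obj j := (q.prop_diag_obj j).2 }⟩⟩

/-- In the situation of `IsCardinalFilteredGenerator.fullSubcategory`, the full subcategory is
strongly `κ`-accessibly embedded. -/
lemma IsCardinalFilteredGenerator.isStronglyAccessiblyEmbedded {P : ObjectProperty C}
    (hP : ∀ (J : Type w) [SmallCategory J] [IsCardinalFiltered J κ],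
      P.IsClosedUnderColimitsOfShape J)
    (h : ((CategoryTheory.isCardinalPresentable C κ).inverseImage
      P.ι).IsCardinalFilteredGenerator κ) :
    P.IsStronglyAccessiblyEmbedded κ where
  closedUnderColimits := hP
  preserves_presentable X hX := by
    -- Presentable objects are retracts of generating ones, and the inclusion preserves retracts.
    obtain ⟨Y, hY, ⟨ρ⟩⟩ := h.isPresentable_eq_retractClosure.le X hX
    have : IsCardinalPresentable (P.ι.obj Y) κ := hY
    exact (ρ.map P.ι).isCardinalPresentable κ

end ObjectProperty

/-! ### Lifting properties -/

namespace MorphismProperty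

lemma cof_le_llp_rlp (W : MorphismProperty C) : W.cof ≤ W.rlp.llp :=
  sInf_le ⟨fun _ _ f (_ : IsIso f) ↦ llp_of_isIso _ f, W.pushouts_le_llp_rlp,
    inferInstance, inferInstance⟩

lemma le_cof (W : MorphismProperty C) : W ≤ W.cof :=
  W.le_pushouts.trans (le_sInf fun _ hV ↦ hV.2.1)

/-- `W.cof` lies between `W` and `W.rlp.llp`, since the latter has all the closure properties
defining `cof`. -/
lemma rlp_cof (W : MorphismProperty C) : W.cof.rlp = W.rlp :=
  le_antisymm (antitone_rlp W.le_cof) (by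
    rw [← le_llp_iff_le_rlp]
    exact W.cof_le_llp_rlp)

end MorphismProperty

/-- If the morphisms in `W` have `κ`-presentable sources and targets, the right lifting property
with respect to `W` is stable under `κ`-filtered colimits. -/
lemma isClosedUnderColimitsOfShape_arrowProperty_rlp [HasCardinalFilteredColimits.{w} C κ]
    (W : MorphismProperty C)
    (hW : ∀ ⦃A B : C⦄ (f : A ⟶ B), W f → IsCardinalPresentable A κ ∧ IsCardinalPresentable B κ)
    (J : Type w) [SmallCategory J] [IsCardinalFiltered J κ] :
    W.rlp.arrowProperty.IsClosedUnderColimitsOfShape J where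
  colimitsOfShape_le := by
    rintro g ⟨p⟩ A B i hi
    have := essentiallySmallSelf J
    obtain ⟨hA, hB⟩ := hW i hi
    have : IsCardinalPresentable (Arrow.mk i) κ :=
      have : IsCardinalPresentable (Arrow.mk i).left κ := hA
      have : IsCardinalPresentable (Arrow.mk i).right κ := hB
      isCardinalPresentable_arrow κ _
    refine ⟨fun {u v} sq ↦ ?_⟩
    -- A lifting problem is a morphism of arrows out of `i`, so it descends to a stage, where a lift
    -- exists.
    obtain ⟨j, φ, hφ⟩ := IsCardinalPresentable.exists_hom_of_isColimit κ p.isColimit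
      (Arrow.homMk u v sq.w : Arrow.mk i ⟶ g)
    have : HasLiftingProperty i (p.diag.obj j).hom := p.prop_diag_obj j i hi
    have sq' : CommSq φ.left i (p.diag.obj j).hom φ.right := ⟨Arrow.w φ⟩
    have hl : φ.left ≫ (p.ι.app j).left = u := congr_arg CommaMorphism.left hφ
    have hr : φ.right ≫ (p.ι.app j).right = v := congr_arg CommaMorphism.right hφ
    have hw : (p.ι.app j).left ≫ g.hom = (p.diag.obj j).hom ≫ (p.ι.app j).right :=
      Arrow.w (p.ι.app j)
    exact ⟨⟨{ l := sq'.lift ≫ (p.ι.app j).left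
              fac_left := by rw [sq'.fac_left_assoc, hl]
              fac_right := by rw [Category.assoc, hw, sq'.fac_right_assoc, hr] }⟩⟩

/-- If `L` has the left lifting property with respect to `R` and a morphism `f` has a
factorization `i ≫ q` with `i` in `L`, then any square from `f` to a morphism `g` in `R` factors
through a square from `q` to `g`. -/
lemma exists_arrow_fac_of_le_llp {L R : MorphismProperty C} (h : L ≤ R.llp) {f g : Arrow C} (φ : f ⟶ g)
    (hg : R g.hom) {M : C} (i : f.left ⟶ M) (q : M ⟶ f.right) (hi : L i) (hf : i ≫ q = f.hom) :
    ∃ (r : f ⟶ Arrow.mk q) (s : Arrow.mk q ⟶ g), r ≫ s = φ := by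
  have : HasLiftingProperty i g.hom := h _ hi _ hg
  have sq : CommSq φ.left i g.hom (q ≫ φ.right) :=
    ⟨by rw [reassoc_of% hf]; exact Arrow.w φ⟩
  exact ⟨Arrow.homMk i (𝟙 _) (by simpa using hf), Arrow.homMk sq.lift φ.right (by simp),
    Arrow.hom_ext _ _ sq.fac_left (Category.id_comp _)⟩

end

end CategoryTheory

theorem theorem4p9 {C : Type u} [Category.{w} C] (κ : Cardinal.{w}) [Fact κ.IsRegular]
    [IsClassLocallyPresentable C κ] (L R : MorphismProperty C)
    (h : MorphismProperty.IsCofibrantlyClassGenerated L R κ) :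
    IsClassAccessible R.arrowProperty.FullSubcategory κ ∧
      R.arrowProperty.IsStronglyAccessiblyEmbedded κ := by
  obtain ⟨W, -, hL, hW⟩ := h.exists_generating
  obtain ⟨P, hP⟩ := IsClassAccessible.exists_generator (C := C) (κ := κ)
  have := h.isWeakFactorizationSystem
  have hR : R = W.rlp := by
    rw [← MorphismProperty.rlp_eq_of_wfs L R, hL, MorphismProperty.rlp_cof]
  have hclosed (J : Type w) [SmallCategory J] [IsCardinalFiltered J κ] :
      R.arrowProperty.IsClosedUnderColimitsOfShape J :=
    hR ▸ isClosedUnderColimitsOfShape_arrowProperty_rlp W hW J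
  have hgen := hP.arrows.fullSubcategory R.arrowProperty hclosed (fun f g φ hf hg ↦ by
    obtain ⟨M, i, q, hi, hq, fac, hM⟩ := h.exists_factorization f.hom hf.1 hf.2
    obtain ⟨r, s, hrs⟩ := exists_arrow_fac_of_le_llp
      (MorphismProperty.llp_eq_of_wfs L R).ge φ hg i q hi fac
    exact ⟨Arrow.mk q, r, s, hrs, hq,
      ObjectProperty.arrows_isCardinalPresentable_le _ ⟨hM, hf.2⟩⟩)
  refine ⟨{ hasColimitsOfShape := fun J _ _ ↦ ?_, exists_generator := ⟨_, hgen⟩ },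
    hgen.isStronglyAccessiblyEmbedded hclosed⟩
  have := hclosed J
  infer_instance
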